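/- Let $(E,g)$ be a real vector space of finite dimension $N\ge 1$ with a scalar product $g$ of Lorentzian signature $(-,+,\dots,+)$ (for instance the tangent space $T_xV$ at any point $x$ of a Lorentzian manifold $V$). Let a time orientation be chosen, with solid future half-cone $\Theta^+$ (the future-pointing causal vectors, together with $0$), and let $\eta$ be a canonical volume element, i.e. an $N$-form with value $1$ on some orthonormal basis. Let $\Lambda_p$ be the space of $p$-forms on $E$. For $n_1,\dots,n_r\in\mathbb{N}$ the elements $A\in\Lambda_{n_1}\otimes\dots\otimes\Lambda_{n_r}$ are the $r$-fold $(n_1,\dots,n_r)$-forms. * For two tensors $B,C$ of the same type, $g(B,C)$ denotes the complete contraction in all indices in order (with no combinatorial factor). * $i_{\vec x_1,\dots,\vec x_r}A\in\Lambda_{n_1-1}\otimes\dots\otimes\Lambda_{n_r-1}$ is the interior contraction of $\vec x_i$ with the first entry of the $i$-th antisymmetric block, for every $i$. It is $0$ if some $n_i=0$. * The Hodge dual of $\omega\in\Lambda_p$ is $(*\omega)_{b_1\dots b_{N-p}}=\frac1{p!}\,\omega^{a_1\dots a_p}\,\eta_{a_1\dots a_pb_1\dots b_{N-p}}$. For $\epsilon\in\{0,1\}^r$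 and $\mathcal P=1+\sum_i 2^{i-1}\epsilon_i$, the multiple Hodge dual $A_{\mathcal P}$ is obtained from $A$ by dualizing exactly the blocks $i$ with $\epsilon_i=1$, so it is an $r$-fold form with block degrees $n_i+\epsilon_i(N-2n_i)$. * For an $r$-fold $(n_1,\dots,n_r)$-form $B$, the $2r$-covariant tensor $B\odot B$ is $$(B\odot B)(\vec x_1,\vec y_1,\dots,\vec x_r,\vec y_r)=\Big(\prod_{i=1}^r\frac1{(n_i-1)!}\Big)\,g\big(i_{\vec x_1,\dots,\vec x_r}B,\;i_{\vec y_1,\dots,\vec y_r}B\big),$$ understood as $0$ if some $n_i=0$. (In particular the dual of a block of maximum degree $N$ contributes $0$.) * The superenergy tensor of $A$ is the $2r$-covariant tensor $$T\{A\}=\frac12\sum_{\mathcal P=1}^{2^r}A_{\mathcal P}\odot A_{\mathcal P}.$$ Then, for every $r\ge 0$, all $n_1,\dots,n_r$ and every $r$-fold $(n_1,\dots,n_r)$-form $A$, the tensor $T\{A\}$ has the dominant property: $$T\{A\}(\vec u_1,\dots,\vec u_{2r})\ge 0\qquad\text{for all }\vec u_1,\dots,\vec u_{2r}\in\Theta^+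 .$$ -/

import Mathlib

open Module
open scoped TensorProduct

noncomputable section

namespace Superenergy

variable {E : Type*} [AddCommGroup E] [Module ℝ E]

/-- `e` is `g`-orthonormal of signature `(-,+,…,+)`, its first vector being the timelike one. -/
def IsOrthonormalFrame {N : ℕ} (g : LinearMap.BilinForm ℝ E) (e : Basis (Fin N) ℝ E) : Prop :=
  ∀ i j, g (e i) (e j) = if i = j then (if (i : ℕ) = 0 then -1 else 1) else 0

/-- A Lorentzian scalar product, of signature `(-,+,…,+)`, on a real vector space of
dimension `N ≥ 1`. -/
structure LorentzMetric (E : Type*) [AddCommGroup E] [Module ℝ E] where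
  /-- the underlying bilinear form -/
  g : LinearMap.BilinForm ℝ E
  finrank_pos : 0 < finrank ℝ E
  exists_frame : ∃ e : Basis (Fin (finrank ℝ E)) ℝ E, IsOrthonormalFrame g e

namespace LorentzMetric

theorem isSymm (L : LorentzMetric E) : L.g.IsSymm := by
  obtain ⟨e, he⟩ := L.exists_frame
  rw [LinearMap.BilinForm.isSymm_iff_flip]
  refine LinearMap.BilinForm.ext_basis e fun i j => ?_
  rw [LinearMap.BilinForm.flip_apply, he, he]
  by_cases h : i = j
  · subst h; rfl
  · rw [if_neg h, if_neg (Ne.symm h)]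

theorem nondegenerate (L : LorentzMetric E) : L.g.Nondegenerate := by
  obtain ⟨e, he⟩ := L.exists_frame
  refine (LinearMap.IsRefl.nondegenerate_iff_separatingLeft L.isSymm.isRefl).2 fun x hx => ?_
  refine e.ext_elem fun j => ?_
  have h : e.repr x j * L.g (e j) (e j) = 0 := by
    rw [← hx (e j)]
    conv_rhs => rw [← e.sum_repr x]
    rw [map_sum, LinearMap.sum_apply, Finset.sum_eq_single j]
    · simp
    · intro i _ hij
      simp [he i j, hij]
    · simp
  rw [he j j, if_pos rfl] at h
  rw [map_zero, Finsupp.zero_apply]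
  split_ifs at h <;> linarith

/-- `η` is a canonical volume element: `η (e₀, …, e_{N-1}) = 1` for some orthonormal frame `e`.
There are two of these, `η` and `-η`, one for each orientation of `E`. -/
def IsVolumeElement (L : LorentzMetric E) (η : E [⋀^Fin (finrank ℝ E)]→ₗ[ℝ] ℝ) : Prop :=
  ∃ e : Basis (Fin (finrank ℝ E)) ℝ E, IsOrthonormalFrame L.g e ∧ η e = 1

/-- A vector is timelike if `g x x < 0`. -/
def IsTimelike (L : LorentzMetric E) (t : E) : Prop := L.g t t < 0

/-- The solid future half-cone, for the time orientation in which the timelike vector `t` is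
future-pointing: the causal vectors in the same half-cone as `t`, and the vector `0`. -/
def futureCone (L : LorentzMetric E) (t : E) : Set E := {x | L.g x x ≤ 0 ∧ L.g t x ≤ 0}

/-- The dominant property of a covariant tensor with entries indexed by `ι`
(so of rank `Fintype.card ι`): it is nonnegative on all families of vectors of the
solid future half-cone. -/
def DominantProperty {ι : Type*} (L : LorentzMetric E) (t : E)
    (T : MultilinearMap ℝ (fun _ : ι => E) ℝ) : Prop :=
  ∀ u : ι → E, (∀ i, u i ∈ L.futureCone t) → 0 ≤ T u

end LorentzMetric

/-- The space `Λ_p` of `p`-forms. -/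
abbrev Form (E : Type*) [AddCommGroup E] [Module ℝ E] (p : ℕ) : Type _ := E [⋀^Fin p]→ₗ[ℝ] ℝ

/-- The interior contraction `Λ_p → Λ_{p-1}` with a vector, as a linear function of the vector:
`(i_x ω) (v₁, …) = ω (x, v₁, …)`; it is zero on `0`-forms. -/
def interior : (p : ℕ) → E →ₗ[ℝ] Form E p →ₗ[ℝ] Form E (p - 1)
  | 0 => 0
  | _ + 1 => AlternatingMap.curryLeftLinearMap.flip

/-- `(i_{u_p} ⋯ i_{u_1} η) (v) = η (u_1, …, u_p, v)`. -/
def iterInterior {q : ℕ} (η : Form E q) : (p : ℕ) → (Fin p → E) → Form E (q - p)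
  | 0, _ => η
  | p + 1, u => interior (q - p) (u (Fin.last p)) (iterInterior η p fun j => u j.castSucc)

/-- The space `Λ_{n_1} ⊗ ⋯ ⊗ Λ_{n_r}` of `r`-fold `(n_1, …, n_r)`-forms. -/
abbrev MultiForm (E : Type*) [AddCommGroup E] [Module ℝ E] {r : ℕ} (n : Fin r → ℕ) : Type _ :=
  ⨂[ℝ] i, Form E (n i)

/-- The degree of a block that is dualized (`ε = true`) or not (`ε = false`). -/
def dualDegree (E : Type*) [AddCommGroup E] [Module ℝ E] (n : ℕ) : Bool → ℕ
  | false => n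
  | true => finrank ℝ E - n

/-- The interior contraction `i_{x_1, …, x_r}`, the `i`-th vector with the `i`-th block. -/
def multiInterior {r : ℕ} (n : Fin r → ℕ) (x : Fin r → E) :
    MultiForm E n →ₗ[ℝ] MultiForm E (fun i => n i - 1) :=
  PiTensorProduct.map fun i => interior (n i) (x i)

theorem multiInterior_update_add {r : ℕ} (n : Fin r → ℕ) (x : Fin r → E) (i : Fin r) (a b : E) :
    multiInterior n (Function.update x i (a + b)) =
      multiInterior n (Function.update x i a) + multiInterior n (Function.update x i b) :=
  ((PiTensorProduct.mapMultilinear ℝ (fun i => Form E (n i))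
    (fun i => Form E (n i - 1))).compLinearMap fun i => interior (n i)).map_update_add x i a b

theorem multiInterior_update_smul {r : ℕ} (n : Fin r → ℕ) (x : Fin r → E) (i : Fin r) (c : ℝ)
    (a : E) :
    multiInterior n (Function.update x i (c • a)) = c • multiInterior n (Function.update x i a) :=
  ((PiTensorProduct.mapMultilinear ℝ (fun i => Form E (n i))
    (fun i => Form E (n i - 1))).compLinearMap fun i => interior (n i)).map_update_smul x i c a

theorem slice_update_self {α ι κ : Type*} [DecidableEq ι] [DecidableEq (ι × κ)] (v : ι × κ → α)
    (i : ι) (k : κ) (a : α) :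
    (fun j => Function.update v (i, k) a (j, k)) = Function.update (fun j => v (j, k)) i a := by
  funext j
  by_cases h : j = i
  · subst h; simp
  · simp [h]

theorem slice_update_of_ne {α ι κ : Type*} [DecidableEq (ι × κ)] (v : ι × κ → α)
    (i : ι) {k l : κ} (a : α) (h : k ≠ l) :
    (fun j => Function.update v (i, k) a (j, l)) = fun j => v (j, l) := by
  funext j
  simp [Ne.symm h]

variable [FiniteDimensional ℝ E]

namespace LorentzMetric

/-- The `g`-dual (reciprocal) basis `c^a` of a basis `c_a`, with `g (c^a, c_b) = δ^a_b`. -/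
def dualBasis (L : LorentzMetric E) {ι : Type*} [Finite ι] [DecidableEq ι] (c : Basis ι ℝ E) :
    Basis ι ℝ E :=
  LinearMap.BilinForm.dualBasis L.g L.nondegenerate c

/-- The complete contraction `α_{a₁…a_p} β^{a₁…a_p}` of two `p`-forms, all indices in order, without
combinatorial factor; it is computed in some basis, and `contraction_eq` says that the basis
is irrelevant. -/
def contraction (L : LorentzMetric E) (p : ℕ) : LinearMap.BilinForm ℝ (Form E p) :=
  LinearMap.mk₂ ℝ
    (fun α β => ∑ a : Fin p → Fin (finrank ℝ E),
      α (fun j => finBasis ℝ E (a j)) * β (fun j => L.dualBasis (finBasis ℝ E) (a j)))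
    (fun α α' β => by simp [add_mul, Finset.sum_add_distrib])
    (fun c α β => by simp [mul_assoc, Finset.mul_sum])
    (fun α β β' => by simp [mul_add, Finset.sum_add_distrib])
    (fun c α β => by simp [mul_left_comm, Finset.mul_sum])

/-- The Hodge dual `(*ω)_{b_1 … b_{N-p}} = (1 / p!) ω^{a₁…a_p} η_{a₁…a_p b_1 … b_{N-p}}`. -/
def hodge (L : LorentzMetric E) (η : Form E (finrank ℝ E)) (p : ℕ) :
    Form E p →ₗ[ℝ] Form E (finrank ℝ E - p) where
  toFun ω := ((p.factorial : ℝ)⁻¹) • ∑ a : Fin p → Fin (finrank ℝ E),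
    ω (fun j => L.dualBasis (finBasis ℝ E) (a j)) •
      iterInterior η p (fun j => finBasis ℝ E (a j))
  map_add' ω ω' := by simp [add_smul, Finset.sum_add_distrib]
  map_smul' c ω := by
    simp only [AlternatingMap.smul_apply, smul_assoc, ← Finset.smul_sum, RingHom.id_apply]
    rw [smul_comm]

/-- The Hodge dual or the identity of one block. -/
def blockDual (L : LorentzMetric E) (η : Form E (finrank ℝ E)) (n : ℕ) :
    (ε : Bool) → Form E n →ₗ[ℝ] Form E (dualDegree E n ε)
  | false => LinearMap.id
  | true => L.hodge η n

/-- The multiple Hodge dual that dualizes the blocks `i` with `ε i = true`. -/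
def multiDual (L : LorentzMetric E) (η : Form E (finrank ℝ E)) {r : ℕ} (n : Fin r → ℕ)
    (ε : Fin r → Bool) : MultiForm E n →ₗ[ℝ] MultiForm E (fun i => dualDegree E (n i) (ε i)) :=
  PiTensorProduct.map fun i => L.blockDual η (n i) (ε i)

/-- The complete contraction of two `r`-fold forms in all indices in order: the bilinear form with
`g (α_1 ⊗ ⋯ ⊗ α_r, β_1 ⊗ ⋯ ⊗ β_r) = ∏ i, g (α_i, β_i)`. -/
def multiContraction (L : LorentzMetric E) {r : ℕ} (n : Fin r → ℕ) :
    LinearMap.BilinForm ℝ (MultiForm E n) :=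
  PiTensorProduct.dualDistrib ∘ₗ PiTensorProduct.map fun i => L.contraction (n i)

/-- The product `A ⊙ A`, a `2r`-covariant tensor: its entry `(i, 0)` is `x_i`, its entry `(i, 1)`
is `y_i`, and
`(A ⊙ A) (x_1, y_1, …, x_r, y_r) = (∏ i, 1 / (n_i - 1)!) g (i_{x_1, …, x_r} A, i_{y_1, …, y_r} A)`.
If some `n_i = 0` then it is zero, as the interior contraction is. -/
def odotSelf (L : LorentzMetric E) {r : ℕ} (n : Fin r → ℕ) (A : MultiForm E n) :
    MultilinearMap ℝ (fun _ : Fin r × Fin 2 => E) ℝ where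
  toFun v := (∏ i, (((n i - 1).factorial : ℝ)⁻¹)) *
    L.multiContraction (fun i => n i - 1)
      (multiInterior n (fun i => v (i, 0)) A) (multiInterior n (fun i => v (i, 1)) A)
  map_update_add' v k a b := by
    obtain ⟨i, j⟩ := k
    fin_cases j
    · simp only [Fin.zero_eta, slice_update_self, slice_update_of_ne _ _ _ zero_ne_one,
        multiInterior_update_add, LinearMap.add_apply, map_add, mul_add]
    · simp only [Fin.mk_one, slice_update_self, slice_update_of_ne _ _ _ one_ne_zero,
        multiInterior_update_add, LinearMap.add_apply, map_add, mul_add]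
  map_update_smul' v k c a := by
    obtain ⟨i, j⟩ := k
    fin_cases j
    · simp only [Fin.zero_eta, slice_update_self, slice_update_of_ne _ _ _ zero_ne_one,
        multiInterior_update_smul, LinearMap.smul_apply, map_smul, smul_eq_mul, mul_left_comm]
    · simp only [Fin.mk_one, slice_update_self, slice_update_of_ne _ _ _ one_ne_zero,
        multiInterior_update_smul, LinearMap.smul_apply, map_smul, smul_eq_mul, mul_left_comm]

/-- The (basic) superenergy tensor `T{A} = ½ ∑ A_P ⊙ A_P`, summed over the `2 ^ r` multiple
Hodge duals `A_P` of `A`. -/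
def superenergy (L : LorentzMetric E) (η : Form E (finrank ℝ E)) {r : ℕ} (n : Fin r → ℕ)
    (A : MultiForm E n) : MultilinearMap ℝ (fun _ : Fin r × Fin 2 => E) ℝ :=
  (1 / 2 : ℝ) • ∑ ε : Fin r → Bool,
    L.odotSelf (fun i => dualDegree E (n i) (ε i)) (L.multiDual η n ε A)

theorem multiContraction_tprod (L : LorentzMetric E) {r : ℕ} (n : Fin r → ℕ)
    (α β : (i : Fin r) → Form E (n i)) :
    L.multiContraction n (PiTensorProduct.tprod ℝ α) (PiTensorProduct.tprod ℝ β) =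
      ∏ i, L.contraction (n i) (α i) (β i) := by
  simp [multiContraction]

theorem contraction_eq (L : LorentzMetric E) (p : ℕ) {ι : Type*} [Fintype ι] [DecidableEq ι]
    (c : Basis ι ℝ E) (α β : Form E p) :
    L.contraction p α β =
      ∑ a : Fin p → ι, α (fun j => c (a j)) * β (fun j => L.dualBasis c (a j)) := by
  classical
  set b := finBasis ℝ E
  have hb : ∀ i, b i = ∑ k, L.g (L.dualBasis c k) (b i) • c k := fun i => by
    refine (c.sum_repr (b i)).symm.trans (Finset.sum_congr rfl fun k _ => ?_)
    congr 1
    have h := LinearMap.BilinForm.dualBasis_repr_apply L.nondegenerate (L.dualBasis c) (b i) k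
    rw [dualBasis, LinearMap.BilinForm.dualBasis_dualBasis L.nondegenerate L.isSymm] at h
    rw [h, L.isSymm.eq]
    rfl
  have hc : ∀ k, L.dualBasis c k = ∑ i, L.g (L.dualBasis c k) (b i) • L.dualBasis b i :=
    fun k => by
      refine ((L.dualBasis b).sum_repr (L.dualBasis c k)).symm.trans
        (Finset.sum_congr rfl fun i _ => ?_)
      rw [dualBasis, LinearMap.BilinForm.dualBasis_repr_apply]
  have e1 : ∀ a : Fin p → Fin (finrank ℝ E), α (fun j => b (a j)) =
      ∑ f : Fin p → ι, (∏ j, L.g (L.dualBasis c (f j)) (b (a j))) * α (fun j => c (f j)) := by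
    intro a
    have : (fun j => b (a j)) = fun j => ∑ k, L.g (L.dualBasis c k) (b (a j)) • c k :=
      funext fun j => hb (a j)
    rw [this]
    have h := α.toMultilinearMap.map_sum (fun j k => L.g (L.dualBasis c k) (b (a j)) • c k)
    refine h.trans (Finset.sum_congr rfl fun f _ => ?_)
    exact α.toMultilinearMap.map_smul_univ _ _
  have e2 : ∀ f : Fin p → ι, β (fun j => L.dualBasis c (f j)) =
      ∑ a : Fin p → Fin (finrank ℝ E), (∏ j, L.g (L.dualBasis c (f j)) (b (a j))) *
        β (fun j => L.dualBasis b (a j)) := by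
    intro f
    have : (fun j => L.dualBasis c (f j)) =
        fun j => ∑ i, L.g (L.dualBasis c (f j)) (b i) • L.dualBasis b i :=
      funext fun j => hc (f j)
    rw [this]
    have h := β.toMultilinearMap.map_sum
      (fun j i => L.g (L.dualBasis c (f j)) (b i) • L.dualBasis b i)
    refine h.trans (Finset.sum_congr rfl fun a _ => ?_)
    exact β.toMultilinearMap.map_smul_univ _ _
  change ∑ a : Fin p → Fin (finrank ℝ E), α (fun j => b (a j)) * β (fun j => L.dualBasis b (a j)) =
    _
  simp_rw [e1, e2, Finset.sum_mul, Finset.mul_sum]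
  rw [Finset.sum_comm]
  refine Finset.sum_congr rfl fun f _ => Finset.sum_congr rfl fun a _ => ?_
  ring

end LorentzMetric

end Superenergy

end

/-! Fix the entries `u`. The `2 ^ r` Hodge duals arise by an independent choice in each block, so
the sum over them factors: `T{A}(u)` is half the value at `(A, A)` of a tensor product, over the
blocks, of bilinear forms on the spaces `Form E (n i)`. The form of a block, `blockEnergy`, adds the
contributions of the block and of its dual (`superenergy_apply`). A tensor product of symmetric
positive semidefinite forms is positive semidefinite
(`PiTensorProduct.dualDistrib_map_self_nonneg`), so the general case, for indecomposable `A` too,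
reduces to a single block.

For one block, `interior_hodge` turns contraction of a dual into the dual of an exterior product,
and `contraction_hodge` says that the Hodge dual reverses the sign of the normalized contraction.
Hence the dual contributes `-g(x♭ ∧ α, y♭ ∧ β) / (p+1)!`. Anticommuting interior and exterior
products gives an expression symmetric in `x` and `y` (`blockEnergy_succ`), hence a symmetric form.

Its positivity is first proved for `x` timelike (`blockEnergy_nonneg_of_isTimelike`): forms
annihilated by `i_x` have nonnegative square, and the energy is a combination of such squares. Null
entries follow by a limit. -/

noncomputable section
namespace Superenergy

/-! ### Interior products -/

section Interior

variable {E : Type*} [AddCommGroup E] [Module ℝ E]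

theorem interior_succ_apply {p : ℕ} (x : E) (ω : Form E (p + 1)) (v : Fin p → E) :
    interior (p + 1) x ω v = ω (Fin.cons x v) :=
  rfl

theorem interior_comm (p : ℕ) (x y : E) (ω : Form E p) :
    interior (p - 1) x (interior p y ω) = -interior (p - 1) y (interior p x ω) := by
  match p, ω with
  | 0, ω => simp [interior]
  | 1, ω => simp [interior]
  | p + 2, ω =>
    have h : ∀ z : E, interior (p + 1) z (interior (p + 2) z ω) = 0 := fun z =>
      ω.curryLeft_same z
    have := h (x + y)
    simp only [map_add, LinearMap.add_apply, h, zero_add, add_zero] at this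
    exact eq_neg_of_add_eq_zero_right this

theorem interior_self (p : ℕ) (x : E) (ω : Form E p) :
    interior (p - 1) x (interior p x ω) = 0 := by
  have h := interior_comm p x x ω
  rw [eq_neg_iff_add_eq_zero, ← two_smul ℝ] at h
  exact (smul_eq_zero.1 h).resolve_left two_ne_zero

/-- Moving `x` from slot `k` to the last slot crosses `p - k` anticommuting contractions. -/
theorem iterInterior_insertNth {p q : ℕ} (η : Form E q) (k : Fin (p + 1)) (x : E)
    (u : Fin p → E) :
    (-1 : ℝ) ^ (k : ℕ) • iterInterior η (p + 1) (k.insertNth x u) =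
      (-1 : ℝ) ^ p • interior (q - p) x (iterInterior η p u) := by
  induction p with
  | zero =>
    obtain rfl : k = 0 := Fin.fin_one_eq_zero k
    simp [iterInterior]
  | succ p ih =>
    induction k using Fin.lastCases with
    | last =>
      rw [Fin.insertNth_last']
      simp only [iterInterior, Fin.snoc_last, Fin.snoc_castSucc, Fin.val_last]
    | cast k =>
      have h1 : (k.castSucc.insertNth x u : Fin (p + 2) → E) (Fin.last (p + 1)) =
          u (Fin.last p) := by
        have := Fin.insertNth_apply_succAbove (α := fun _ => E) k.castSucc x u (Fin.last p)
        rwa [Fin.succAbove_of_lt_succ _ _ (by simp), Fin.succ_last] at this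
      have h2 : (fun j : Fin (p + 1) => (k.castSucc.insertNth x u : Fin (p + 2) → E) j.castSucc) =
          k.insertNth x (fun j => u j.castSucc) := by
        refine (Fin.insertNth_eq_iff (α := fun _ => E)).2 ⟨?_, ?_⟩ |>.symm
        · simp
        · funext j
          have := Fin.insertNth_apply_succAbove (α := fun _ => E) k.castSucc x u j.castSucc
          rw [Fin.castSucc_succAbove_castSucc] at this
          exact this.symm
      have h3 : interior (q - (p + 1)) (u (Fin.last p))
          (interior (q - p) x (iterInterior η p fun j => u j.castSucc)) =
            -interior (q - (p + 1)) x (iterInterior η (p + 1) u) :=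
        interior_comm (q - p) (u (Fin.last p)) x _
      rw [iterInterior, h1, h2, Fin.val_castSucc, ← map_smul, ih, map_smul, h3, pow_succ, mul_smul,
        neg_one_smul, smul_neg]

theorem iterInterior_apply_of_eq {p q : ℕ} (h : p = q) (η : Form E q) (u : Fin p → E)
    (v : Fin (q - p) → E) : iterInterior η p u v = η fun j => u (j.cast h.symm) := by
  -- The induction on `p` needs `q` fixed, hence the generalization from `p = q` to `p ≤ q`.
  have key : ∀ (p : ℕ) (hp : p ≤ q) (u : Fin p → E) (v : Fin (q - p) → E),
      iterInterior η p u v =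
        η fun j => if h : (j : ℕ) < p then u ⟨j, h⟩ else v ⟨j - p, by omega⟩ := by
    intro p
    induction p with
    | zero => intro hp u v; simp [iterInterior]
    | succ p ih =>
      intro hp u v
      have aux : ∀ (m : ℕ) (hm : m = q - (p + 1) + 1) (x : E) (ω : Form E m)
          (v : Fin (m - 1) → E),
          interior m x ω v = ω fun j => if h : (j : ℕ) = 0 then x else v ⟨j - 1, by omega⟩ := by
        rintro m hm x ω v
        obtain ⟨m, rfl⟩ : ∃ k, m = k + 1 := ⟨_, hm⟩
        rw [interior_succ_apply]
        congr 1
        funext j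
        induction j using Fin.cases <;> simp
      rw [iterInterior]
      refine (aux (q - p) (by omega) _ _ v).trans ?_
      rw [ih (by omega)]
      congr 1
      funext j
      rcases lt_trichotomy (j : ℕ) p with hj | hj | hj
      · rw [dif_pos hj, dif_pos (by omega)]
        rfl
      · rw [dif_neg (by omega), dif_pos (by simp [hj]), dif_pos (by omega)]
        congr 1
        ext
        simp [hj]
      · rw [dif_neg (by omega), dif_neg (by simp; omega), dif_neg (by omega)]
        rfl
  rw [key p h.le]
  congr 1
  funext j
  rw [dif_pos (by omega)]
  rfl

end Interior

/-! ### Exterior product with a covector -/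

section Wedge

variable {E : Type*} [AddCommGroup E] [Module ℝ E]

namespace LorentzMetric

/-- The exterior product `x♭ ∧ α` of the `g`-dual of a vector with a form. -/
def wedge (L : LorentzMetric E) {p : ℕ} (x : E) : Form E p →ₗ[ℝ] Form E (p + 1) :=
  AlternatingMap.alternatizeUncurryFinLM ∘ₗ LinearMap.smulRightₗ (L.g x)

theorem wedge_apply (L : LorentzMetric E) {p : ℕ} (x : E) (α : Form E p) (v : Fin (p + 1) → E) :
    L.wedge x α v = ∑ k : Fin (p + 1), (-1) ^ (k : ℕ) * (L.g x (v k) * α (k.removeNth v)) := by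
  simp [wedge, AlternatingMap.alternatizeUncurryFin_apply]

theorem interior_wedge_zero (L : LorentzMetric E) (x y : E) (α : Form E 0) :
    interior 1 x (L.wedge y α) = L.g y x • α := by
  ext v
  rw [interior_succ_apply, wedge_apply]
  simp

theorem interior_wedge (L : LorentzMetric E) {p : ℕ} (x y : E) (α : Form E (p + 1)) :
    interior (p + 2) x (L.wedge y α) =
      L.g y x • α - L.wedge (p := p) y (interior (p + 1) x α) := by
  ext v
  rw [interior_succ_apply, AlternatingMap.sub_apply, wedge_apply, wedge_apply, Fin.sum_univ_succ,
    sub_eq_add_neg, ← Finset.sum_neg_distrib]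
  congr 1
  · simp [Fin.removeNth_zero]
  · refine Finset.sum_congr rfl fun k _ => ?_
    rw [interior_succ_apply, Fin.val_succ, pow_succ, Fin.cons_succ]
    have : k.succ.removeNth (Fin.cons x v : Fin (p + 2) → E) =
        (Fin.cons x (k.removeNth v) : Fin (p + 1) → E) := by
      funext j
      induction j using Fin.cases <;> simp [Fin.removeNth]
    rw [this]
    ring

theorem sum_smul_dualBasis (L : LorentzMetric E) {ι : Type*} [Fintype ι] [DecidableEq ι]
    (c : Basis ι ℝ E) (x : E) : ∑ i, L.g x (L.dualBasis c i) • c i = x := by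
  conv_rhs => rw [← c.sum_repr x]
  refine Finset.sum_congr rfl fun i _ => ?_
  congr 1
  have h := LinearMap.BilinForm.dualBasis_repr_apply L.nondegenerate (L.dualBasis c) x i
  rw [dualBasis, LinearMap.BilinForm.dualBasis_dualBasis L.nondegenerate L.isSymm] at h
  exact h.symm

/-- The signs in the expansion of `x♭ ∧ α` cancel against the antisymmetry of `Φ`, leaving `p + 1`
equal terms. Both `contraction_wedge` and `interior_hodge` are instances. -/
theorem sum_wedge_smul (L : LorentzMetric E) {ι : Type*} [Fintype ι] [DecidableEq ι]
    (c : Basis ι ℝ E) {F : Type*} [AddCommGroup F] [Module ℝ F] {p : ℕ} (x : E) (α : Form E p)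
    (Φ : (Fin (p + 1) → E) → F) (Ψ : (Fin p → E) → E →ₗ[ℝ] F)
    (h : ∀ (k : Fin (p + 1)) (y : E) (u : Fin p → E),
      (-1 : ℝ) ^ (k : ℕ) • Φ (k.insertNth y u) = Ψ u y) :
    ∑ a : Fin (p + 1) → ι, L.wedge x α (fun j => L.dualBasis c (a j)) • Φ (fun j => c (a j)) =
      (p + 1 : ℝ) • ∑ a : Fin p → ι,
        α (fun j => L.dualBasis c (a j)) • Ψ (fun j => c (a j)) x := by
  simp_rw [wedge_apply, Finset.sum_smul]
  rw [Finset.sum_comm]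
  have : ∀ k : Fin (p + 1), ∑ a : Fin (p + 1) → ι,
      ((-1 : ℝ) ^ (k : ℕ) * (L.g x (L.dualBasis c (a k)) *
        α (k.removeNth fun j => L.dualBasis c (a j)))) • Φ (fun j => c (a j)) =
      ∑ a : Fin p → ι, α (fun j => L.dualBasis c (a j)) • Ψ (fun j => c (a j)) x := by
    intro k
    rw [← (Fin.insertNthEquiv (fun _ => ι) k).sum_comp, Fintype.sum_prod_type, Finset.sum_comm]
    refine Finset.sum_congr rfl fun a _ => ?_
    conv_rhs => rw [← L.sum_smul_dualBasis c x, map_sum, Finset.smul_sum]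
    refine Finset.sum_congr rfl fun i _ => ?_
    have e1 : (fun j => c ((k.insertNth i a : Fin (p + 1) → ι) j)) =
        (k.insertNth (c i) fun j => c (a j) : Fin (p + 1) → E) := by
      refine (Fin.insertNth_eq_iff (α := fun _ => E)).2 ⟨?_, ?_⟩ |>.symm
      · simp
      · funext j; simp [Fin.removeNth]
    have e2 : (k.removeNth fun j => L.dualBasis c ((k.insertNth i a : Fin (p + 1) → ι) j)) =
        fun j => L.dualBasis c (a j) := by
      funext j; simp [Fin.removeNth]
    simp only [Fin.insertNthEquiv_apply, Fin.insertNth_apply_same]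
    rw [e1, e2, map_smul, ← h k]
    simp only [smul_smul]
    congr 1
    ring
  rw [Finset.sum_congr rfl fun k _ => this k]
  simp [← Nat.cast_smul_eq_nsmul ℝ]

end LorentzMetric

end Wedge

/-! ### Contraction of forms and the Hodge dual -/

section Contraction

variable {E : Type*} [AddCommGroup E] [Module ℝ E]

namespace LorentzMetric

theorem dualBasis_dualBasis (L : LorentzMetric E) {ι : Type*} [Finite ι] [DecidableEq ι]
    (c : Basis ι ℝ E) : L.dualBasis (L.dualBasis c) = c :=
  LinearMap.BilinForm.dualBasis_dualBasis L.nondegenerate L.isSymm c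

theorem apply_comm (L : LorentzMetric E) (x y : E) : L.g x y = L.g y x :=
  L.isSymm.eq x y

theorem IsOrthonormalFrame.dualBasis_apply (L : LorentzMetric E) {N : ℕ} {e : Basis (Fin N) ℝ E}
    (he : IsOrthonormalFrame L.g e) (i : Fin N) :
    L.dualBasis e i = (if (i : ℕ) = 0 then -1 else 1 : ℝ) • e i := by
  have h : ⇑(L.dualBasis e) = fun i : Fin N => (if (i : ℕ) = 0 then -1 else 1 : ℝ) • e i := by
    rw [dualBasis, LinearMap.BilinForm.dualBasis_eq_iff]
    intro i j
    rw [map_smul, LinearMap.smul_apply, he]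
    by_cases hij : i = j
    · subst hij; split_ifs <;> simp_all
    · simp [hij, Ne.symm hij]
  rw [h]

theorem form_sum_apply {ι : Type*} (s : Finset ι) {p : ℕ} (f : ι → Form E p) (v : Fin p → E) :
    (∑ i ∈ s, f i) v = ∑ i ∈ s, f i v :=
  map_sum (⟨⟨fun ω : Form E p => ω v, rfl⟩, fun _ _ => rfl⟩ : Form E p →+ ℝ) f s

variable [FiniteDimensional ℝ E]

theorem contraction_comm (L : LorentzMetric E) (p : ℕ) (α β : Form E p) :
    L.contraction p α β = L.contraction p β α := by
  rw [L.contraction_eq p (finBasis ℝ E), L.contraction_eq p (L.dualBasis (finBasis ℝ E)) β α,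
    dualBasis_dualBasis]
  exact Finset.sum_congr rfl fun a _ => mul_comm _ _

theorem contraction_of_eq_zero (L : LorentzMetric E) {p : ℕ} (h : p = 0) (v : Fin p → E)
    (α β : Form E p) : L.contraction p α β = α v * β v := by
  subst h
  rw [L.contraction_eq 0 (finBasis ℝ E)]
  simp [Subsingleton.elim _ v]

theorem contraction_eq_sum_interior (L : LorentzMetric E) {p : ℕ} (hp : 0 < p) {ι : Type*}
    [Fintype ι] [DecidableEq ι] (c : Basis ι ℝ E) (α β : Form E p) :
    L.contraction p α β = ∑ i, L.contraction (p - 1) (interior p (c i) α)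
      (interior p (L.dualBasis c i) β) := by
  obtain ⟨p, rfl⟩ : ∃ k, p = k + 1 := ⟨p - 1, by omega⟩
  simp_rw [L.contraction_eq _ c]
  rw [← (Fin.consEquiv fun _ => ι).sum_comp, Fintype.sum_prod_type]
  refine Finset.sum_congr rfl fun i _ => Finset.sum_congr rfl fun a _ => ?_
  have h : ∀ b : Basis ι ℝ E, (fun j => b ((Fin.consEquiv fun _ => ι) (i, a) j)) =
      (Fin.cons (b i) fun j => b (a j) : Fin (p + 1) → E) := fun b => by
    funext j
    induction j using Fin.cases <;> simp [Fin.consEquiv]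
  rw [h, h]
  rfl

/-- Exterior and interior products are adjoint up to the factor `p + 1`, as the contraction has no
combinatorial normalization. -/
theorem contraction_wedge (L : LorentzMetric E) {p : ℕ} (x : E) (α : Form E p)
    (ω : Form E (p + 1)) :
    L.contraction (p + 1) (L.wedge x α) ω =
      (p + 1) * L.contraction p α (interior (p + 1) x ω) := by
  set b := finBasis ℝ E
  rw [L.contraction_eq _ (L.dualBasis b), L.contraction_eq _ (L.dualBasis b), dualBasis_dualBasis]
  exact L.sum_wedge_smul b x α ω (fun u =>
    { toFun := fun y => interior (p + 1) y ω u
      map_add' := fun y z => by rw [map_add]; rfl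
      map_smul' := fun c y => by rw [map_smul]; rfl }) fun k y u => by
    rw [AlternatingMap.map_insertNth, ← Int.cast_smul_eq_zsmul ℝ, smul_smul, Int.cast_pow,
      ← mul_pow]
    simp only [Matrix.vecCons, Int.cast_neg, Int.cast_one, mul_neg, mul_one, neg_neg, one_pow,
      one_smul]
    rfl

theorem interior_hodge (L : LorentzMetric E) (η : Form E (finrank ℝ E)) (p : ℕ) (x : E)
    (α : Form E p) :
    interior (finrank ℝ E - p) x (L.hodge η p α) =
      (-1 : ℝ) ^ p • L.hodge η (p + 1) (L.wedge x α) := by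
  have h := L.sum_wedge_smul (finBasis ℝ E) x α (iterInterior η (p + 1))
    (fun u => (-1 : ℝ) ^ p • (interior (finrank ℝ E - p)).flip (iterInterior η p u))
    fun k y u => iterInterior_insertNth η k y u
  simp only [hodge, LinearMap.coe_mk, AddHom.coe_mk]
  rw [h, map_smul, map_sum]
  have e : (-1 : ℝ) ^ p * (-1 : ℝ) ^ p = 1 := by rw [← mul_pow]; simp
  have e' : (((p + 1).factorial : ℝ)⁻¹) * (p + 1) = (p.factorial : ℝ)⁻¹ := by
    rw [Nat.factorial_succ]
    push_cast
    field_simp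
  rw [smul_smul, smul_smul, mul_assoc, e', mul_comm, mul_smul]
  congr 1
  rw [Finset.smul_sum]
  refine Finset.sum_congr rfl fun a _ => ?_
  rw [map_smul, LinearMap.smul_apply, smul_comm, smul_smul ((-1 : ℝ) ^ p), e, one_smul]
  rfl

theorem contraction_wedge_wedge_zero (L : LorentzMetric E) (x y : E) (α β : Form E 0) :
    L.contraction 1 (L.wedge x α) (L.wedge y β) = L.g x y * L.contraction 0 α β := by
  rw [contraction_wedge, interior_wedge_zero, map_smul, L.apply_comm]
  simp

theorem contraction_wedge_wedge (L : LorentzMetric E) {p : ℕ} (x y : E) (α β : Form E (p + 1)) :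
    L.contraction (p + 2) (L.wedge x α) (L.wedge y β) =
      (p + 2) * (L.g x y * L.contraction (p + 1) α β -
        (p + 1) * L.contraction p (interior (p + 1) y α) (interior (p + 1) x β)) := by
  rw [contraction_wedge, interior_wedge, map_sub, map_smul, L.contraction_comm _ α (L.wedge _ _),
    contraction_wedge, L.apply_comm, L.contraction_comm p (interior (p + 1) x β)]
  push_cast
  simp only [smul_eq_mul]
  ring

/-- The trace of `g` gives the dimension; tracing the interior term of `contraction_wedge_wedge`
removes `p`. -/
theorem sum_contraction_wedge_wedge (L : LorentzMetric E) {p : ℕ} (α β : Form E p) :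
    ∑ i, L.contraction (p + 1) (L.wedge (finBasis ℝ E i) α)
      (L.wedge (L.dualBasis (finBasis ℝ E) i) β) =
      (p + 1) * ((finrank ℝ E : ℝ) - p) * L.contraction p α β := by
  have hg : ∀ i, L.g (finBasis ℝ E i) (L.dualBasis (finBasis ℝ E) i) = 1 := fun i => by
    rw [L.apply_comm, dualBasis, LinearMap.BilinForm.apply_dualBasis_left, if_pos rfl]
  match p, α, β with
  | 0, α, β =>
    refine (Finset.sum_congr rfl fun i _ => (L.contraction_wedge_wedge_zero _ _ α β).trans
      (by rw [hg i, one_mul])).trans ?_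
    simp
  | p + 1, α, β =>
    have h := L.contraction_eq_sum_interior p.succ_pos (L.dualBasis (finBasis ℝ E)) α β
    rw [dualBasis_dualBasis] at h
    have h' : L.contraction (p + 1) α β = ∑ i, L.contraction p
        (interior (p + 1) (L.dualBasis (finBasis ℝ E) i) α)
        (interior (p + 1) (finBasis ℝ E i) β) := h
    simp_rw [contraction_wedge_wedge, hg]
    rw [← Finset.mul_sum, Finset.sum_sub_distrib, ← Finset.mul_sum, ← Finset.mul_sum, ← h']
    simp
    ring

theorem contraction_top (L : LorentzMetric E) {e : Basis (Fin (finrank ℝ E)) ℝ E}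
    (he : IsOrthonormalFrame L.g e) (α β : Form E (finrank ℝ E)) :
    L.contraction (finrank ℝ E) α β = -((finrank ℝ E).factorial * (α e * β e)) := by
  -- The minus sign comes from the single timelike vector of the frame.
  have hdet : e.det (L.dualBasis e) = -1 := by
    rw [show ⇑(L.dualBasis e) = fun i : Fin (finrank ℝ E) =>
      (if (i : ℕ) = 0 then -1 else 1 : ℝ) • e i from
      funext (IsOrthonormalFrame.dualBasis_apply L he)]
    refine (e.det.toMultilinearMap.map_smul_univ _ _).trans ?_
    have h0 : ∀ i : Fin (finrank ℝ E), (i : ℕ) = 0 ↔ i = ⟨0, L.finrank_pos⟩ := fun i => by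
      rw [Fin.ext_iff]
    simp_rw [h0]
    rw [Finset.prod_ite_eq' Finset.univ (⟨0, L.finrank_pos⟩ : Fin (finrank ℝ E)) fun _ => (-1 : ℝ)]
    simpa using e.det_self
  have hsum : ∑ a : Fin (finrank ℝ E) → Fin (finrank ℝ E),
      e.det (fun j => e (a j)) * e.det (fun j => L.dualBasis e (a j)) =
        ∑ _σ : Equiv.Perm (Fin (finrank ℝ E)), (-1 : ℝ) := by
    symm
    refine Finset.sum_of_injOn (fun σ : Equiv.Perm (Fin (finrank ℝ E)) => ⇑σ)
      (DFunLike.coe_injective.injOn) (fun _ _ => Finset.mem_coe.2 (Finset.mem_univ _)) ?_ ?_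
    · intro a _ ha
      have hinj : ¬ Function.Injective a := fun h => ha
        ⟨Equiv.ofBijective a (Finite.injective_iff_bijective.1 h), by simp, rfl⟩
      rw [e.det.map_eq_zero_of_not_injective, zero_mul]
      exact fun h => hinj (Function.Injective.of_comp (f := e) h)
    · intro σ _
      have h1 := e.det.map_perm e σ
      have h2 := e.det.map_perm (L.dualBasis e) σ
      rw [hdet] at h2
      rw [e.det_self] at h1
      refine (Eq.trans (congrArg₂ (· * ·) h1 h2) ?_).symm
      rcases Int.units_eq_one_or (Equiv.Perm.sign σ) with h | h <;> simp [h]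
  rw [α.eq_smul_basis_det e, β.eq_smul_basis_det e, L.contraction_eq _ e]
  simp only [AlternatingMap.smul_apply, smul_eq_mul, e.det_self, mul_one]
  simp_rw [mul_mul_mul_comm]
  rw [← Finset.mul_sum, hsum]
  simp [Fintype.card_perm]
  ring

/-- Induction on the codegree `q`, starting from top degree, where the dual is a scalar. In the
step, the contraction of the duals is expanded by interior products, which pass through the dual as
exterior products of degree `p + 1`. -/
theorem contraction_hodge (L : LorentzMetric E) {η : Form E (finrank ℝ E)}
    (hη : L.IsVolumeElement η) (q p : ℕ) (h : p + q = finrank ℝ E) (α β : Form E p) :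
    (p.factorial : ℝ) * L.contraction (finrank ℝ E - p) (L.hodge η p α) (L.hodge η p β) =
      -((q.factorial : ℝ) * L.contraction p α β) := by
  induction q generalizing p with
  | zero =>
    obtain rfl : p = finrank ℝ E := h
    obtain ⟨e, he, he1⟩ := hη
    have hod : ∀ (ω : Form E (finrank ℝ E)) (v), L.hodge η (finrank ℝ E) ω v = - ω e := by
      intro ω v
      have : L.hodge η (finrank ℝ E) ω v =
          ((finrank ℝ E).factorial : ℝ)⁻¹ * L.contraction _ η ω := by
        rw [L.contraction_eq _ (finBasis ℝ E)]
        simp only [hodge, LinearMap.coe_mk, AddHom.coe_mk]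
        rw [AlternatingMap.smul_apply, smul_eq_mul, form_sum_apply]
        congr 1
        refine Finset.sum_congr rfl fun a _ => ?_
        rw [AlternatingMap.smul_apply, iterInterior_apply_of_eq rfl, smul_eq_mul, mul_comm]
        rfl
      rw [this, L.contraction_top he, he1]
      field_simp
    rw [L.contraction_of_eq_zero (Nat.sub_self _) (fun _ => 0), hod, hod, L.contraction_top he]
    simp
  | succ q ih =>
    rw [L.contraction_eq_sum_interior (by omega) (finBasis ℝ E)]
    have e : (-1 : ℝ) ^ p * (-1 : ℝ) ^ p = 1 := by rw [← mul_pow]; simp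
    have hq : (finrank ℝ E : ℝ) - p = q + 1 := by
      rw [← h]
      push_cast
      ring
    have h1 : ∀ i, L.contraction (finrank ℝ E - p - 1)
        (interior (finrank ℝ E - p) (finBasis ℝ E i) (L.hodge η p α))
        (interior (finrank ℝ E - p) (L.dualBasis (finBasis ℝ E) i) (L.hodge η p β)) =
          -((q.factorial : ℝ) * L.contraction (p + 1) (L.wedge (finBasis ℝ E i) α)
            (L.wedge (L.dualBasis (finBasis ℝ E) i) β)) / (p + 1).factorial := fun i => by
      rw [← ih (p + 1) (by omega), interior_hodge, interior_hodge, map_smul, map_smul,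
        LinearMap.smul_apply, smul_smul, e, one_smul]
      field_simp
      rfl
    simp_rw [h1]
    rw [← Finset.sum_div, Finset.sum_neg_distrib, ← Finset.mul_sum, sum_contraction_wedge_wedge,
      hq, Nat.factorial_succ, Nat.factorial_succ]
    push_cast
    field_simp

end LorentzMetric

end Contraction

/-! ### Positivity of the energy of one block -/

section Positivity

variable {E : Type*} [AddCommGroup E] [Module ℝ E]

theorem interior_of_eq_zero {p : ℕ} (hp : p = 0) (x : E) (ω : Form E p) : interior p x ω = 0 := by
  subst hp
  rfl

namespace LorentzMetric

theorem exists_frame_of_isTimelike (L : LorentzMetric E) {x : E} (hx : L.IsTimelike x) :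
    ∃ e : Basis (Fin (finrank ℝ E)) ℝ E, IsOrthonormalFrame L.g e ∧
      ∃ c : ℝ, e ⟨0, L.finrank_pos⟩ = c • x := by
  obtain ⟨e, he⟩ := L.exists_frame
  set e₀ := e ⟨0, L.finrank_pos⟩
  have he₀ : L.g e₀ e₀ = -1 := by simp [e₀, he _ _]
  -- The sign of `s` makes `v = e₀ + s • x` timelike, so the reflection along `v` exists; it sends
  -- `e₀` to `-s • x`.
  obtain ⟨s, hs, hs'⟩ : ∃ s : ℝ, s ^ 2 * L.g x x = -1 ∧ s * L.g e₀ x ≤ 0 := by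
    have hx' : 0 < -L.g x x := neg_pos.2 hx
    have h1 : (√(-L.g x x))⁻¹ ^ 2 * L.g x x = -1 := by
      rw [inv_pow, Real.sq_sqrt hx'.le]
      field_simp [hx.ne]
    have h2 : 0 ≤ (√(-L.g x x))⁻¹ := by positivity
    rcases le_total (L.g e₀ x) 0 with h | h
    · exact ⟨_, h1, mul_nonpos_of_nonneg_of_nonpos h2 h⟩
    · exact ⟨-(√(-L.g x x))⁻¹, by rw [neg_sq, h1], by nlinarith⟩
  set v := e₀ + s • x with hv
  have hxe : L.g x e₀ = L.g e₀ x := L.apply_comm _ _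
  have hvv : L.g v v = -2 + 2 * (s * L.g e₀ x) := by
    simp only [hv, map_add, LinearMap.add_apply, map_smul, LinearMap.smul_apply, smul_eq_mul, he₀,
      hxe]
    linear_combination hs
  have hve : L.g v e₀ = -1 + s * L.g e₀ x := by
    simp only [hv, map_add, LinearMap.add_apply, map_smul, LinearMap.smul_apply, smul_eq_mul, he₀,
      hxe]
  have hne : L.g v v ≠ 0 := by rw [hvv]; linarith
  have hf : ((2 / L.g v v) • L.g v) v = 2 := by
    rw [LinearMap.smul_apply, smul_eq_mul, div_mul_cancel₀ _ hne]
  refine ⟨e.map (Module.reflection hf), fun i j => ?_, -s, ?_⟩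
  · rw [← he i j, Basis.map_apply, Basis.map_apply, Module.reflection_apply,
      Module.reflection_apply]
    simp only [map_sub, LinearMap.sub_apply, map_smul, LinearMap.smul_apply, smul_eq_mul,
      L.apply_comm (e i) v]
    field_simp
    ring
  · rw [Basis.map_apply, Module.reflection_apply]
    change e₀ - _ = _
    have : ((2 / L.g v v) • L.g v) e₀ = 1 := by
      rw [LinearMap.smul_apply, smul_eq_mul, hve, div_mul_eq_mul_div, div_eq_one_iff_eq hne, hvv]
      ring
    rw [show ((2 / L.g v v) • L.g v) (e ⟨0, L.finrank_pos⟩) = 1 from this, one_smul, hv, neg_smul]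
    abel

theorem interior_wedge_of_interior_eq_zero (L : LorentzMetric E) {p : ℕ} {x : E} (y : E)
    {ω : Form E p} (h : interior p x ω = 0) :
    interior (p + 1) x (L.wedge y ω) = L.g y x • ω := by
  match p, ω, h with
  | 0, ω, _ => exact L.interior_wedge_zero x y ω
  | p + 1, ω, h =>
    refine (L.interior_wedge x y ω).trans ?_
    rw [h]
    exact (congrArg _ (map_zero (L.wedge (p := p) y))).trans (sub_zero _)

variable [FiniteDimensional ℝ E]

/-- In a frame whose timelike vector is proportional to `x`, every component with a time index
vanishes, and the others contribute squares. -/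
theorem contraction_self_nonneg (L : LorentzMetric E) {x : E} (hx : L.IsTimelike x) {p : ℕ}
    {ω : Form E p} (h : interior p x ω = 0) : 0 ≤ L.contraction p ω ω := by
  obtain ⟨e, he, c, hc⟩ := L.exists_frame_of_isTimelike hx
  rw [L.contraction_eq p e]
  refine Finset.sum_nonneg fun a _ => ?_
  by_cases ha : ∃ j, a j = ⟨0, L.finrank_pos⟩
  · obtain ⟨j, hj⟩ := ha
    obtain ⟨p, rfl⟩ : ∃ k, p = k + 1 := ⟨p - 1, by have := j.2; omega⟩
    have : ω (fun j => e (a j)) = 0 := by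
      rw [← Fin.insertNth_self_removeNth j fun j => e (a j), AlternatingMap.map_insertNth, hj, hc]
      have h' := congrArg (fun α : Form E p => α (j.removeNth fun j => e (a j)))
        ((map_smul (interior (p + 1)) c x ▸ rfl :
          interior (p + 1) (c • x) ω = c • interior (p + 1) x ω).trans (by rw [h, smul_zero]))
      change ω (Fin.cons _ _) = 0 at h'
      rw [Matrix.vecCons, h', smul_zero]
    rw [this, zero_mul]
  · push Not at ha
    have : (fun j => L.dualBasis e (a j)) = fun j => e (a j) := by
      funext j
      have hj : ((a j : Fin _) : ℕ) ≠ 0 := fun h0 => ha j (Fin.ext h0)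
      rw [IsOrthonormalFrame.dualBasis_apply L he, if_neg hj, one_smul]
    rw [this]
    exact mul_self_nonneg _

theorem contraction_eq_zero_of_finrank_lt (L : LorentzMetric E) {p : ℕ} (hp : finrank ℝ E < p)
    (α β : Form E p) : L.contraction p α β = 0 := by
  rw [L.contraction_eq p (finBasis ℝ E)]
  refine Finset.sum_eq_zero fun a _ => ?_
  rw [α.map_eq_zero_of_not_injective, zero_mul]
  intro h
  have := Fintype.card_le_of_injective a (Function.Injective.of_comp (f := finBasis ℝ E) h)
  simp at this
  omega

theorem contraction_interior_hodge (L : LorentzMetric E) {η : Form E (finrank ℝ E)}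
    (hη : L.IsVolumeElement η) (p : ℕ) (x y : E) (α β : Form E p) :
    ((finrank ℝ E - p - 1).factorial : ℝ)⁻¹ * L.contraction (finrank ℝ E - p - 1)
      (interior (finrank ℝ E - p) x (L.hodge η p α))
      (interior (finrank ℝ E - p) y (L.hodge η p β)) =
    -(((p + 1).factorial : ℝ)⁻¹ * L.contraction (p + 1) (L.wedge x α) (L.wedge y β)) := by
  rcases lt_or_ge p (finrank ℝ E) with h | h
  · have e : (-1 : ℝ) ^ p * (-1 : ℝ) ^ p = 1 := by rw [← mul_pow]; simp
    have h1 := L.contraction_hodge hη (finrank ℝ E - p - 1) (p + 1) (by omega) (L.wedge x α)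
      (L.wedge y β)
    rw [interior_hodge, interior_hodge, map_smul, map_smul, LinearMap.smul_apply, smul_smul, e,
      one_smul]
    field_simp
    exact (mul_comm _ _).trans h1
  -- Here the truncated degree of the dual is `0`, and forms of degree `p + 1` exceed the dimension:
  -- both sides vanish.
  · rw [interior_of_eq_zero (by omega) x, L.contraction_eq_zero_of_finrank_lt (p := p + 1) (by omega)]
    simp

theorem apply_self_nonneg (L : LorentzMetric E) {t u : E} (ht : L.IsTimelike t)
    (h : L.g t u = 0) : 0 ≤ L.g u u := by
  -- The covector `u♭` is obtained as the exterior product of `u♭` with the `0`-form `1`.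
  have h1 := L.interior_wedge_zero t u (AlternatingMap.constOfIsEmpty ℝ E (Fin 0) 1)
  rw [L.apply_comm, h, zero_smul] at h1
  have h2 := L.contraction_self_nonneg ht h1
  rw [contraction_wedge_wedge_zero, L.contraction_of_eq_zero rfl 0] at h2
  simpa using h2

theorem apply_neg (L : LorentzMetric E) {t x y : E} (ht : L.IsTimelike t) (hx : L.IsTimelike x)
    (hy : L.IsTimelike y) (htx : L.g t x < 0) (hty : L.g t y < 0) : L.g x y < 0 := by
  -- This combination is orthogonal to `t`; if `g x y ≥ 0`, its square would be negative.
  have h := L.apply_self_nonneg ht (u := L.g t y • x - L.g t x • y)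
    (by simp only [map_sub, map_smul, smul_eq_mul]; ring)
  simp only [map_sub, map_smul, smul_eq_mul, LinearMap.sub_apply, LinearMap.smul_apply,
    L.apply_comm y x] at h
  unfold IsTimelike at hx hy
  by_contra! hxy
  have h1 := mul_neg_of_pos_of_neg (pow_pos (neg_pos.2 hty) 2) hx
  have h2 := mul_neg_of_pos_of_neg (pow_pos (neg_pos.2 htx) 2) hy
  have h3 := mul_nonneg (mul_pos (neg_pos.2 hty) (neg_pos.2 htx)).le hxy
  linarith

/-- The superenergy of one block with its two vector entries fixed, as a bilinear form. -/
def blockEnergy (L : LorentzMetric E) (p : ℕ) (x y : E) : LinearMap.BilinForm ℝ (Form E p) :=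
  ((p - 1).factorial : ℝ)⁻¹ • (L.contraction (p - 1)).compl₁₂ (interior p x) (interior p y) -
    ((p + 1).factorial : ℝ)⁻¹ • (L.contraction (p + 1)).compl₁₂ (L.wedge x) (L.wedge y)

theorem blockEnergy_apply (L : LorentzMetric E) (p : ℕ) (x y : E) (α β : Form E p) :
    L.blockEnergy p x y α β =
      ((p - 1).factorial : ℝ)⁻¹ * L.contraction (p - 1) (interior p x α) (interior p y β) -
        ((p + 1).factorial : ℝ)⁻¹ * L.contraction (p + 1) (L.wedge x α) (L.wedge y β) := by
  simp [blockEnergy]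

theorem blockEnergy_zero (L : LorentzMetric E) (x y : E) (α β : Form E 0) :
    L.blockEnergy 0 x y α β = -(L.g x y * L.contraction 0 α β) := by
  rw [blockEnergy_apply]
  have := L.contraction_wedge_wedge_zero x y α β
  rw [interior_of_eq_zero rfl]
  simp [this]

theorem blockEnergy_succ (L : LorentzMetric E) {p : ℕ} (x y : E) (α β : Form E (p + 1)) :
    p.factorial * L.blockEnergy (p + 1) x y α β =
      L.contraction p (interior (p + 1) x α) (interior (p + 1) y β) +
      L.contraction p (interior (p + 1) y α) (interior (p + 1) x β) -
      L.g x y / (p + 1) * L.contraction (p + 1) α β := by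
  have h : L.blockEnergy (p + 1) x y α β = (p.factorial : ℝ)⁻¹ *
      L.contraction p (interior (p + 1) x α) (interior (p + 1) y β) -
        ((p + 2).factorial : ℝ)⁻¹ * L.contraction (p + 2) (L.wedge x α) (L.wedge y β) :=
    L.blockEnergy_apply (p + 1) x y α β
  rw [h, contraction_wedge_wedge]
  simp only [Nat.factorial_succ]
  push_cast
  field_simp
  ring

/-- Exchanging `α` and `β` amounts to exchanging `x` and `y`, under which `blockEnergy_succ` is
visibly invariant. -/
theorem blockEnergy_isSymm (L : LorentzMetric E) (p : ℕ) (x y : E) :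
    (L.blockEnergy p x y).IsSymm := by
  refine ⟨fun α β => ?_⟩
  match p, α, β with
  | 0, α, β => simp [blockEnergy_zero, L.contraction_comm 0 α β]
  | p + 1, α, β =>
    refine mul_left_cancel₀ (Nat.cast_ne_zero.2 p.factorial_ne_zero : (p.factorial : ℝ) ≠ 0) ?_
    rw [blockEnergy_succ, blockEnergy_succ, L.contraction_comm _ α β,
      L.contraction_comm p (interior _ x α), L.contraction_comm p (interior _ y α)]
    ring

theorem blockEnergy_nonneg_of_isTimelike (L : LorentzMetric E) {x y : E} (hx : L.IsTimelike x)
    (hy : L.g y y ≤ 0) (hxy : L.g x y < 0) (p : ℕ) (α : Form E p) :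
    0 ≤ L.blockEnergy p x y α α := by
  match p, α with
  | 0, α =>
    rw [blockEnergy_zero, L.contraction_of_eq_zero rfl 0]
    nlinarith [mul_self_nonneg (α 0)]
  | p + 1, α =>
    obtain ⟨h, hh⟩ : ∃ h, h = -L.g x x := ⟨_, rfl⟩
    have hpos : 0 < h := by rw [hh]; exact neg_pos.2 hx
    obtain ⟨c, hc⟩ : ∃ c, c = -L.g x y / h := ⟨_, rfl⟩
    have hcpos : 0 < c := by rw [hc]; exact div_pos (neg_pos.2 hxy) hpos
    have hxy' : L.g x y = -(c * h) := by rw [hc]; field_simp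
    -- `w` is the part of `y` orthogonal to `x`; causality of `y` bounds its square by `c ^ 2 * h`.
    obtain ⟨w, hw⟩ : ∃ w, w = y - c • x := ⟨_, rfl⟩
    have hxw : L.g x w = 0 := by
      rw [hw, map_sub, map_smul, hxy', smul_eq_mul, hh]
      ring
    have hwx : L.g w x = 0 := by rw [L.apply_comm, hxw]
    have hyw : y = c • x + w := by rw [hw]; abel
    have hww : L.g w w ≤ c ^ 2 * h := by
      rw [hyw] at hy
      simp only [map_add, map_smul, smul_eq_mul, LinearMap.add_apply, LinearMap.smul_apply, hxw,
        hwx] at hy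
      rw [hh]
      linarith
    set β : Form E p := interior (p + 1) x α with hβ
    have hβx : interior p x β = 0 := interior_self (p + 1) x α
    -- Electric-magnetic splitting of `α` relative to `x`: both `β` and `γ` are annihilated by
    -- `i_x`.
    set γ : Form E (p + 1) := h • α + L.wedge x β with hγ
    have hwβ : ∀ z, interior (p + 1) x (L.wedge z β) = L.g z x • β := fun z =>
      L.interior_wedge_of_interior_eq_zero z hβx
    have hγx : interior (p + 1) x γ = 0 := by
      rw [hγ, map_add, map_smul, hwβ, ← hβ, ← add_smul, hh]
      simp
    set δ : Form E p := interior (p + 1) w γ with hδ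
    have hδx : interior p x δ = 0 := by
      have := interior_comm (p + 1) x w γ
      rw [hγx, map_zero, neg_zero] at this
      exact this
    obtain ⟨σ, hσ⟩ : ∃ σ : Form E p, σ = interior (p + 1) w α := ⟨_, rfl⟩
    have hp : (0 : ℝ) < p + 1 := by positivity
    have hk : L.contraction (p + 1) γ γ = h ^ 2 * L.contraction (p + 1) α α +
        (p + 1) * h * L.contraction p β β := by
      have h1 := L.contraction_wedge x β α
      have h2 := L.contraction_wedge x β (L.wedge x β)
      rw [hwβ, map_smul, smul_eq_mul] at h2
      rw [hγ]
      simp only [map_add, map_smul, smul_eq_mul, LinearMap.add_apply, LinearMap.smul_apply,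
        L.contraction_comm (p + 1) α (L.wedge x β)]
      rw [h1, h2, hh, ← hβ]
      ring
    have hb : L.contraction p β δ = h * L.contraction p β σ := by
      have h1 := L.contraction_wedge w β (L.wedge x β)
      rw [L.contraction_comm, L.contraction_wedge, hwβ, hwx, zero_smul, map_zero, mul_zero] at h1
      have h2 := (mul_eq_zero.1 h1.symm).resolve_left hp.ne'
      rw [hδ, hγ, map_add, map_smul, map_add, map_smul, smul_eq_mul]
      rw [h2, add_zero, hσ]
    have hkpos := L.contraction_self_nonneg hx hγx
    -- A Cauchy-Schwarz type bound: `w♭ ∧ γ` is also annihilated by `i_x`, so its square is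
    -- nonnegative.
    have hcs : (p + 1) * L.contraction p δ δ ≤ L.g w w * L.contraction (p + 1) γ γ := by
      have h1 := L.interior_wedge_of_interior_eq_zero w hγx
      rw [hwx, zero_smul] at h1
      have h2 := L.contraction_self_nonneg hx h1
      have h3 := L.contraction_wedge_wedge w w γ γ
      rw [h3] at h2
      exact sub_nonneg.1 (nonneg_of_mul_nonneg_right h2 (by positivity))
    have hsq : 0 ≤ (c * h) ^ 2 * L.contraction p β β + 2 * (c * h) * L.contraction p β δ +
        L.contraction p δ δ := by
      have h1 : interior p x ((c * h) • β + δ) = 0 := by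
        rw [map_add, map_smul, hβx, hδx, smul_zero, add_zero]
      have h2 := L.contraction_self_nonneg hx h1
      simp only [map_add, map_smul, smul_eq_mul, LinearMap.add_apply, LinearMap.smul_apply,
        L.contraction_comm p δ β] at h2
      linarith
    have hS := L.blockEnergy_succ x y α α
    have hyα : interior (p + 1) y α = c • β + σ := by
      rw [hyw, map_add, map_smul, hσ]; rfl
    rw [hyα, ← hβ, L.contraction_comm p _ β, hxy'] at hS
    simp only [map_add, map_smul, smul_eq_mul] at hS
    refine nonneg_of_mul_nonneg_right (a := (p.factorial : ℝ)) ?_ (by positivity)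
    rw [hS]
    -- After this scaling the energy is `p + 1` times the square in `hsq`, plus `c ^ 2 * h * g(γ, γ)
    -- - (p + 1) * g(δ, δ)`, which is nonnegative by `hcs` and `hww`.
    refine nonneg_of_mul_nonneg_right (a := c * h ^ 2 * (p + 1)) ?_ (by positivity)
    rw [hb] at hsq
    have hcs' := hcs.trans (mul_le_mul_of_nonneg_right hww hkpos)
    rw [hk] at hcs'
    have := mul_nonneg hp.le hsq
    field_simp
    linarith

theorem blockEnergy_nonneg (L : LorentzMetric E) {t : E} (ht : L.IsTimelike t) {x y : E}
    (hx : x ∈ L.futureCone t) (hy : y ∈ L.futureCone t) (p : ℕ) (α : Form E p) :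
    0 ≤ L.blockEnergy p x y α α := by
  -- Adding `ε • t` makes both entries strictly timelike; the energy is then a quadratic polynomial
  -- in `ε`, and `ε` tends to `0` from above.
  have key : ∀ z ∈ L.futureCone t, ∀ ε : ℝ, 0 < ε →
      L.IsTimelike (z + ε • t) ∧ L.g t (z + ε • t) < 0 := by
    rintro z ⟨h1, h2⟩ ε hε
    have h3 : ε * L.g t t < 0 := mul_neg_of_pos_of_neg hε ht
    constructor
    · unfold IsTimelike
      simp only [map_add, map_smul, smul_eq_mul, LinearMap.add_apply, LinearMap.smul_apply,
        L.apply_comm z t]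
      nlinarith
    · simp only [map_add, map_smul, smul_eq_mul]
      linarith
  have hpos : ∀ ε : ℝ, 0 < ε → 0 ≤ L.blockEnergy p (x + ε • t) (y + ε • t) α α := fun ε hε =>
    L.blockEnergy_nonneg_of_isTimelike (key x hx ε hε).1 (key y hy ε hε).1.le
      (L.apply_neg ht (key x hx ε hε).1 (key y hy ε hε).1 (key x hx ε hε).2 (key y hy ε hε).2) p α
  have hexp : ∀ ε : ℝ, L.blockEnergy p (x + ε • t) (y + ε • t) α α =
      L.blockEnergy p x y α α + ε * (L.blockEnergy p t y α α + L.blockEnergy p x t α α) +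
        ε ^ 2 * L.blockEnergy p t t α α := fun ε => by
    have hw : ∀ z : E, L.wedge (z + ε • t) α = L.wedge z α + ε • L.wedge t α := fun z => by
      ext v
      simp only [wedge_apply, AlternatingMap.add_apply, AlternatingMap.smul_apply, smul_eq_mul,
        map_add, map_smul, LinearMap.add_apply, LinearMap.smul_apply, Finset.mul_sum,
        ← Finset.sum_add_distrib]
      exact Finset.sum_congr rfl fun k _ => by ring
    simp only [blockEnergy_apply, hw, map_add, map_smul, LinearMap.add_apply,
      LinearMap.smul_apply, smul_eq_mul]
    ring
  have hlim : Filter.Tendsto (fun ε : ℝ => L.blockEnergy p x y α α +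
      ε * (L.blockEnergy p t y α α + L.blockEnergy p x t α α) + ε ^ 2 * L.blockEnergy p t t α α)
      (nhdsWithin 0 (Set.Ioi 0)) (nhds (L.blockEnergy p x y α α)) := by
    refine tendsto_nhdsWithin_of_tendsto_nhds (Continuous.tendsto' (by fun_prop) _ _ (by simp))
  refine ge_of_tendsto hlim ?_
  filter_upwards [self_mem_nhdsWithin] with ε hε
  rw [← hexp]
  exact hpos ε hε

end LorentzMetric

end Positivity

/-! ### Tensor products of positive semidefinite forms -/

section TensorProduct

theorem _root_.LinearMap.BilinForm.exists_sum_mul_of_isSymm_of_nonneg {M : Type*}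
    [AddCommGroup M] [Module ℝ M] [FiniteDimensional ℝ M] {B : LinearMap.BilinForm ℝ M}
    (hB : B.IsSymm) (h : ∀ x, 0 ≤ B x x) :
    ∃ φ : Fin (finrank ℝ M) → Dual ℝ M, ∀ x y, B x y = ∑ k, φ k x * φ k y := by
  obtain ⟨v, hv⟩ := LinearMap.BilinForm.exists_orthogonal_basis ⟨hB.eq⟩
  refine ⟨fun k => √(B (v k) (v k)) • v.coord k, fun x y => ?_⟩
  conv_lhs => rw [← v.sum_repr x, ← v.sum_repr y]
  simp only [map_sum, LinearMap.sum_apply]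
  refine Finset.sum_congr rfl fun k _ => ?_
  rw [Finset.sum_eq_single k]
  · simp only [map_smul, LinearMap.smul_apply, smul_eq_mul, Basis.coord_apply]
    rw [mul_mul_mul_comm, Real.mul_self_sqrt (h _)]
    ring
  · intro j _ hj
    have : B (v j) (v k) = 0 := hv hj
    simp [this]
  · simp

/-- A tensor product of finitely many positive semidefinite symmetric bilinear forms is
positive semidefinite. -/
theorem _root_.PiTensorProduct.dualDistrib_map_self_nonneg {ι : Type*} [Fintype ι]
    {M : ι → Type*} [∀ i, AddCommGroup (M i)] [∀ i, Module ℝ (M i)]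
    [∀ i, FiniteDimensional ℝ (M i)] (B : ∀ i, LinearMap.BilinForm ℝ (M i))
    (hB : ∀ i, (B i).IsSymm) (h : ∀ i x, 0 ≤ B i x x) (A : ⨂[ℝ] i, M i) :
    0 ≤ PiTensorProduct.dualDistrib (PiTensorProduct.map B A) A := by
  classical
  choose φ hφ using fun i =>
    LinearMap.BilinForm.exists_sum_mul_of_isSymm_of_nonneg (hB i) (h i)
  let ψ : (∀ i, Fin (finrank ℝ (M i))) → Dual ℝ (⨂[ℝ] i, M i) := fun f =>
    PiTensorProduct.dualDistrib (PiTensorProduct.tprod ℝ fun i => φ i (f i))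
  -- Each `B i` is a sum of squares of functionals; expanding the product makes the tensor product
  -- one as well, with functionals `ψ f`.
  have key : PiTensorProduct.dualDistrib ∘ₗ PiTensorProduct.map B =
      ∑ f, (ψ f).smulRight (ψ f) := by
    ext a b
    simp [ψ, hφ, Finset.prod_univ_sum, Finset.prod_mul_distrib]
  have := LinearMap.congr_fun (LinearMap.congr_fun key A) A
  rw [LinearMap.comp_apply] at this
  rw [this]
  simp only [LinearMap.sum_apply, LinearMap.smulRight_apply, LinearMap.smul_apply, smul_eq_mul]
  exact Finset.sum_nonneg fun f _ => mul_self_nonneg _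

end TensorProduct

/-! ### Factorization of the superenergy tensor -/

section Superenergy

variable {E : Type*} [AddCommGroup E] [Module ℝ E] [FiniteDimensional ℝ E]

instance (p : ℕ) : FiniteDimensional ℝ (Form E p) :=
  Module.Finite.of_injective
    (AlternatingMap.toMultilinearMapLM (R := ℝ) (S := ℝ) (M := E) (N := ℝ) (ι := Fin p))
    AlternatingMap.coe_multilinearMap_injective

namespace LorentzMetric

theorem sum_blockDual (L : LorentzMetric E) {η : Form E (finrank ℝ E)}
    (hη : L.IsVolumeElement η) (p : ℕ) (x y : E) (α β : Form E p) :
    ∑ ε : Bool, ((dualDegree E p ε - 1).factorial : ℝ)⁻¹ * L.contraction (dualDegree E p ε - 1)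
      (interior (dualDegree E p ε) x (L.blockDual η p ε α))
      (interior (dualDegree E p ε) y (L.blockDual η p ε β)) = L.blockEnergy p x y α β := by
  rw [Fintype.sum_bool, blockEnergy_apply, add_comm, sub_eq_add_neg,
    ← L.contraction_interior_hodge hη]
  rfl

theorem superenergy_apply (L : LorentzMetric E) {η : Form E (finrank ℝ E)}
    (hη : L.IsVolumeElement η) {r : ℕ} (n : Fin r → ℕ) (A : MultiForm E n)
    (u : Fin r × Fin 2 → E) :
    L.superenergy η n A u = 1 / 2 * PiTensorProduct.dualDistrib
      (PiTensorProduct.map (fun i => L.blockEnergy (n i) (u (i, 0)) (u (i, 1))) A) A := by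
  -- Stated for bilinear forms in two arguments, so that it suffices to compare pure tensors, where
  -- a product of two-term sums expands into the sum over `ε`.
  have key : ∑ ε : Fin r → Bool, (∏ i, (((dualDegree E (n i) (ε i) - 1).factorial : ℝ)⁻¹)) •
      (L.multiContraction fun i => dualDegree E (n i) (ε i) - 1).compl₁₂
        (multiInterior (fun i => dualDegree E (n i) (ε i)) (fun i => u (i, 0)) ∘ₗ
          L.multiDual η n ε)
        (multiInterior (fun i => dualDegree E (n i) (ε i)) (fun i => u (i, 1)) ∘ₗ
          L.multiDual η n ε) =
      PiTensorProduct.dualDistrib ∘ₗ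
        PiTensorProduct.map fun i => L.blockEnergy (n i) (u (i, 0)) (u (i, 1)) := by
    ext α β
    simp only [LinearMap.compMultilinearMap_apply, LinearMap.sum_apply, LinearMap.smul_apply,
      LinearMap.compl₁₂_apply, LinearMap.comp_apply, multiInterior, multiDual,
      PiTensorProduct.map_tprod, multiContraction_tprod, PiTensorProduct.dualDistrib_apply,
      ← L.sum_blockDual hη, Finset.prod_univ_sum, Fintype.piFinset_univ, Finset.prod_mul_distrib,
      smul_eq_mul]
  rw [← LinearMap.comp_apply, ← key]
  simp [superenergy, odotSelf]

end LorentzMetric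

end Superenergy

end Superenergy

end

/-- The superenergy tensor of every `r`-fold form on a Lorentzian vector space has the
dominant property, for both orientations and both time orientations. -/
theorem mainTheorem7 {E : Type*} [AddCommGroup E] [Module ℝ E] [FiniteDimensional ℝ E]
    (L : Superenergy.LorentzMetric E)
    (η : Superenergy.Form E (Module.finrank ℝ E)) (hη : L.IsVolumeElement η)
    (t : E) (ht : L.IsTimelike t)
    {r : ℕ} (n : Fin r → ℕ) (A : Superenergy.MultiForm E n) :
    L.DominantProperty t (L.superenergy η n A) := by
  intro u hu
  rw [L.superenergy_apply hη]
  exact mul_nonneg (by norm_num) (PiTensorProduct.dualDistrib_map_self_nonneg _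
    (fun i => L.blockEnergy_isSymm _ _ _)
    (fun i => L.blockEnergy_nonneg ht (hu _) (hu _) (n i)) A)
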